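/- Let $H_m=\sum_{j=1}^{m}\frac1j$ denote the harmonic numbers, with $H_0=0$. For every integer $n\ge 1$ and every real $t$ with $0<t\le 1$, the series on the left below converges, in the sense that its partial sums over $1\le k\le N$ converge as $N\to\infty$, and its sum is \begin{align*} \sum_{k=1}^{\infty}\frac{(-t)^kH_{k-1}}{\binom{n+k}{k}} ={}&\frac{t\log(t+1)}{t+1} +\frac{t}{(t+1)^2}\sum_{k=1}^n\frac{H_k}{k}\left(\frac{t+1}{t}\right)^k -\frac{t^2+t\log(t+1)}{(t+1)^2}\sum_{k=1}^n\frac1k\left(\frac{t+1}{t}\right)^k\\ &-\frac{\log^2(t+1)}{2(t+1)^2}\sum_{k=1}^n k\left(\frac{t+1}{t}\right)^k -\frac{t}{(t+1)^2}\sum_{p=0}^{n-1}\left\{\sum_{k=1}^{n-p}\left(\frac{H_{k+p}-H_k}{k(k+p)}+\frac{1}{k^2(k+p)}\right)\right\}p\left(\frac{t+1}{t}\right)^p\\ &-\frac{1}{(t+1)^2}\sum_{p=0}^{n-1}\left\{\sum_{k=1}^{n-p}\left(\frac{H_{k+p}-H_k}{k(k+p)}+\frac{1}{k^2(k+p)}\right)\right\}p^2\left(\frac{t+1}{t}\right)^p\\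 &-\frac{2t-t\log(t+1)}{(t+1)^2}\sum_{k=1}^nH_k\left(\frac{t+1}{t}\right)^k +\frac{\log(t+1)}{(t+1)^2}\sum_{k=1}^nkH_k\left(\frac{t+1}{t}\right)^k\\ &+\frac{4t\log(t+1)-t\log^2(t+1)}{2(t+1)^2}\sum_{k=1}^n\left(\frac{t+1}{t}\right)^k . \end{align*} -/

import Mathlib

open Filter Topology

/-- The inner finite sum
`∑_{k=1}^{n-p} ((H_{k+p} - H_k) / (k (k+p)) + 1 / (k² (k+p)))`, as a real number
(used only for `p < n`). Here `harmonic m` is the harmonic number `H_m`, with `H_0 = 0`. -/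
noncomputable def innerHarmonicSum (n p : ℕ) : ℝ :=
  ∑ k ∈ Finset.Icc 1 (n - p),
    (((harmonic (k + p) : ℝ) - (harmonic k : ℝ)) / ((k : ℝ) * ((k : ℝ) + (p : ℝ)))
      + 1 / ((k : ℝ) ^ 2 * ((k : ℝ) + (p : ℝ))))

/-!
Write `x = (t + 1) / t` and `l = log (t + 1)`. The beta integral
`1 / binom(n + k, k) = n ∫₀¹ (1 - u)^(n-1) u^k du` turns the series into
`n ∫₀¹ (1 - u)^(n-1) f(t u) du`, where
`f z = ∑_{k ≥ 1} H_{k-1} (-z)^k = log (1 + z) - log (1 + z) / (1 + z)`. At `t = 1` the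
partial sums do not converge uniformly to `f` on `[0, 1)`, and for `n = 1` the series of the
theorem converges only conditionally; but the partial sum up to `N + 1` differs from
`f z` by at most `(H_N + 1) z^(N+1)`
(`abs_sum_harmonic_sub_generating_le`), whose integral is of order `log N / N`. This gives
`tendsto_sum_harmonic_div_choose`.

The integral is computed by recursion on `n`. Since `t (1 - u) = (t + 1) - (1 + t u)`, raising
the power of `1 - u` by one multiplies `∫ (1 - u)^n t / (1 + t u)` and
`∫ (1 - u)^n log (1 + t u) / (1 + t u)` by `x`, up to a simpler integral
(`integral_one_sub_pow_div`, `integral_one_sub_pow_mul_log_div`). The result is an expression in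
`x ^ n`, `H_n`, `∑ x^(n-j) / j` and `∑ H_{j-1} x^(n-j) / j`.

It remains to match this with the stated right-hand side, by induction on `n`
(`right_side_eq`). The double sum is the only term whose summands depend on `n`. Passing from `n`
to `n + 1` adds `(H_{n+1} - H_{n-p}) / ((n + 1 - p) (n + 1))` to the inner sum, and the total
increment (`innerTotal_succ`) reduces to the same two sums together with convolutions of `1`, `j`,
`H_{j-1}` and `j H_{j-1}` against powers of `x`, which are summed by parts.
-/

/-! ### Convolutions with powers -/

/-- The convolution `∑_{j < N} a_j x^{N-1-j}`. The truncated subtraction in the exponent is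
harmless, as `j < N`. -/
noncomputable def horner (x : ℝ) (a : ℕ → ℝ) (N : ℕ) : ℝ :=
  ∑ j ∈ Finset.range N, a j * x ^ (N - 1 - j)

lemma horner_zero (x : ℝ) (a : ℕ → ℝ) : horner x a 0 = 0 := by simp [horner]

lemma horner_succ (x : ℝ) (a : ℕ → ℝ) (N : ℕ) :
    horner x a (N + 1) = x * horner x a N + a N := by
  unfold horner
  rw [Finset.sum_range_succ, Finset.mul_sum]
  congr 1
  · refine Finset.sum_congr rfl fun j hj => ?_
    have hj := Finset.mem_range.1 hj
    rw [show N + 1 - 1 - j = (N - 1 - j) + 1 by omega, pow_succ]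
    ring
  · simp

lemma harmonic_succ_real (n : ℕ) :
    (harmonic (n + 1) : ℝ) = harmonic n + 1 / ((n : ℝ) + 1) := by
  rw [harmonic_succ]; push_cast; ring

/-- `∑_{j=1}^N x^{N-j} / j`. -/
noncomputable def invSum (x : ℝ) : ℕ → ℝ := horner x fun j => 1 / ((j : ℝ) + 1)

/-- `∑_{j=1}^N H_{j-1} x^{N-j} / j`. -/
noncomputable def harmonicInvSum (x : ℝ) : ℕ → ℝ :=
  horner x fun j => (harmonic j : ℝ) / ((j : ℝ) + 1)

section ClosedForms
variable {t x : ℝ} (hx : x * t = t + 1)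
include hx

lemma horner_one (N : ℕ) : horner x (fun _ => 1) N = t * (x ^ N - 1) := by
  induction N with
  | zero => simp [horner_zero]
  | succ N ih => rw [horner_succ, ih]; linear_combination (-1) * hx

lemma horner_index (N : ℕ) :
    horner x (fun j => (j : ℝ) + 1) N = t * (x ^ N + t * (x ^ N - 1) - 1 - N) := by
  induction N with
  | zero => simp [horner_zero]
  | succ N ih =>
    rw [horner_succ, ih]; push_cast
    linear_combination (-t - 1 - N) * hx

lemma horner_harmonic (N : ℕ) :
    horner x (fun j => (harmonic j : ℝ)) N = t * (invSum x N - harmonic N) := by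
  induction N with
  | zero => simp [horner_zero, invSum]
  | succ N ih =>
    rw [horner_succ, ih, invSum, horner_succ, harmonic_succ_real]
    linear_combination (-(harmonic N : ℝ)) * hx

lemma horner_index_mul_harmonic (N : ℕ) :
    horner x (fun j => ((j : ℝ) + 1) * (harmonic j : ℝ)) N =
      t * (t * (x ^ N - 1) + invSum x N + t * (invSum x N - harmonic N)
        - (N + 1) * harmonic N) := by
  induction N with
  | zero => simp [horner_zero, invSum]
  | succ N ih =>
    rw [horner_succ, ih, invSum, horner_succ, harmonic_succ_real]
    have hr : ((N : ℝ) + 1) * (1 / ((N : ℝ) + 1)) = 1 := by field_simp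
    push_cast
    linear_combination (-t - (t + N + 1) * (harmonic N : ℝ)) * hx + t * hr

end ClosedForms

/-! ### The double sum -/

lemma innerHarmonicSum_self (n : ℕ) : innerHarmonicSum n n = 0 := by simp [innerHarmonicSum]

/-- The increment is the new summand, at `k = n + 1 - p`, in the simpler form that results from
`-H_k + 1 / k = -H_{k-1}`. -/
lemma innerHarmonicSum_succ {n p : ℕ} (hp : p ≤ n) :
    innerHarmonicSum (n + 1) p = innerHarmonicSum n p +
      ((harmonic (n + 1) : ℝ) - harmonic (n - p)) /
        (((n - p : ℕ) + 1 : ℝ) * ((n : ℝ) + 1)) := by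
  obtain ⟨k, rfl⟩ := Nat.exists_eq_add_of_le' hp
  unfold innerHarmonicSum
  rw [show k + p + 1 - p = k + 1 by omega, show k + p - p = k by omega,
    Finset.sum_Icc_succ_top (by omega), show k + 1 + p = k + p + 1 by omega,
    harmonic_succ_real k]
  have h1 : (k : ℝ) + 1 ≠ 0 := by positivity
  have h2 : (k : ℝ) + p + 1 ≠ 0 := by positivity
  have h3 : (k : ℝ) + 1 + p ≠ 0 := by positivity
  push_cast
  field_simp
  ring

/-- The sum `∑_{p < n} innerHarmonicSum n p * p * (t + p) * x^p`, which joins the terms with weights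
`t p` and `p²`. -/
noncomputable def innerTotal (t x : ℝ) (n : ℕ) : ℝ :=
  ∑ p ∈ Finset.range n, innerHarmonicSum n p * ((p : ℝ) * (t + p)) * x ^ p

/-- With `N = n + 1` and `j = N - p`, the increment is
`∑_j (H_N - H_{j-1}) (N - j) (t + N - j) / (j N) * x^(N-j)`. Expanding
`(N - j) (t + N - j) / j = N (N + t) / j - (2 N + t) + j` splits it into convolutions. -/
lemma innerTotal_succ {t x : ℝ} (hx : x * t = t + 1) (n : ℕ) :
    innerTotal t x (n + 1) = innerTotal t x n +
      (harmonic (n + 1) * ((n + 1) * (n + 1 + t) * invSum x (n + 1)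
          - (2 * (n + 1) + t) * (t * (x ^ (n + 1) - 1))
          + t * (x ^ (n + 1) + t * (x ^ (n + 1) - 1) - 1 - (n + 1)))
        - ((n + 1) * (n + 1 + t) * harmonicInvSum x (n + 1)
          - (2 * (n + 1) + t) * (t * (invSum x (n + 1) - harmonic (n + 1)))
          + t * (t * (x ^ (n + 1) - 1) + invSum x (n + 1)
              + t * (invSum x (n + 1) - harmonic (n + 1))
              - (n + 1 + 1) * harmonic (n + 1)))) / (n + 1) := by
  -- The term `p = n` may be included, as `innerHarmonicSum n n` is an empty sum.
  have e1 : innerTotal t x n = ∑ p ∈ Finset.range (n + 1),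
      innerHarmonicSum n p * ((p : ℝ) * (t + p)) * x ^ p := by
    rw [Finset.sum_range_succ, innerHarmonicSum_self]; simp [innerTotal]
  have e2 : innerTotal t x (n + 1) = innerTotal t x n + ∑ p ∈ Finset.range (n + 1),
      ((harmonic (n + 1) : ℝ) - harmonic (n - p)) /
        (((n - p : ℕ) + 1 : ℝ) * ((n : ℝ) + 1)) * ((p : ℝ) * (t + p)) * x ^ p := by
    rw [e1, ← Finset.sum_add_distrib]
    refine Finset.sum_congr rfl fun p hp => ?_
    rw [innerHarmonicSum_succ (by have := Finset.mem_range.1 hp; omega)]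
    ring
  have g1 := horner_one hx (n + 1)
  have g2 := horner_index hx (n + 1)
  have g3 := horner_harmonic hx (n + 1)
  have g4 := horner_index_mul_harmonic hx (n + 1)
  push_cast at g1 g2 g3 g4
  rw [e2, ← Finset.sum_range_reflect, ← g4, ← g2, ← g1, ← g3]
  congr 1
  unfold harmonicInvSum invSum horner
  simp only [Finset.mul_sum, ← Finset.sum_sub_distrib, ← Finset.sum_add_distrib,
    Finset.sum_div]
  refine Finset.sum_congr rfl fun j hj => ?_
  have hj' : j ≤ n := by have := Finset.mem_range.1 hj; omega
  obtain ⟨k, rfl⟩ := Nat.exists_eq_add_of_le' hj'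
  rw [show k + j + 1 - 1 - j = k by omega, show k + j - k = j by omega]
  have h1 : (j : ℝ) + 1 ≠ 0 := by positivity
  have h2 : (k : ℝ) + j + 1 ≠ 0 := by positivity
  push_cast
  field_simp
  ring

/-- Both sides are polynomials in `l`, which is arbitrary here. -/
lemma right_side_eq {t x l : ℝ} (ht : 0 < t) (hx : x = (t + 1) / t) (n : ℕ) :
    t * l / (t + 1)
        + t / (t + 1) ^ 2
            * ∑ k ∈ Finset.Icc 1 (n + 1), (harmonic k : ℝ) / (k : ℝ) * x ^ k
        - (t ^ 2 + t * l) / (t + 1) ^ 2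
            * ∑ k ∈ Finset.Icc 1 (n + 1), 1 / (k : ℝ) * x ^ k
        - l ^ 2 / (2 * (t + 1) ^ 2)
            * ∑ k ∈ Finset.Icc 1 (n + 1), (k : ℝ) * x ^ k
        - 1 / (t + 1) ^ 2 * innerTotal t x (n + 1)
        - (2 * t - t * l) / (t + 1) ^ 2
            * ∑ k ∈ Finset.Icc 1 (n + 1), (harmonic k : ℝ) * x ^ k
        + l / (t + 1) ^ 2
            * ∑ k ∈ Finset.Icc 1 (n + 1), (k : ℝ) * (harmonic k : ℝ) * x ^ k
        + (4 * t * l - t * l ^ 2) / (2 * (t + 1) ^ 2)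
            * ∑ k ∈ Finset.Icc 1 (n + 1), x ^ k =
      x ^ (n + 1) * l - invSum x (n + 1)
        - (n + 1) * (x ^ n / t * (l ^ 2 / 2 - l * harmonic n)
          + (harmonic n * invSum x n - harmonicInvSum x n) / t) := by
  have hx' : x * t = t + 1 := by rw [hx]; field_simp
  have ht1 : t + 1 ≠ 0 := by positivity
  induction n with
  | zero =>
    simp [innerTotal, invSum, harmonicInvSum, horner]
    rw [hx]; field_simp; ring
  | succ n ih =>
    have hn1 : (n : ℝ) + 1 ≠ 0 := by positivity
    have hn2 : (n : ℝ) + 1 + 1 ≠ 0 := by positivity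
    have i1 : invSum x (n + 2) = x * invSum x (n + 1) + 1 / ((n : ℝ) + 1 + 1) := by
      rw [invSum, horner_succ]; push_cast; rfl
    have i2 : harmonicInvSum x (n + 2) =
        x * harmonicInvSum x (n + 1) + harmonic (n + 1) / ((n : ℝ) + 1 + 1) := by
      rw [harmonicInvSum, horner_succ]; push_cast; rfl
    have i3 : invSum x (n + 1) = x * invSum x n + 1 / ((n : ℝ) + 1) := by
      rw [invSum, horner_succ]
    have i4 : harmonicInvSum x (n + 1) =
        x * harmonicInvSum x n + harmonic n / ((n : ℝ) + 1) := by
      rw [harmonicInvSum, horner_succ]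
    have i5 := harmonic_succ_real (n + 1)
    have i6 := harmonic_succ_real n
    have i7 := innerTotal_succ hx' (n + 1)
    push_cast at i5 i7
    simp only [Finset.sum_Icc_succ_top (show 1 ≤ n + 1 + 1 by omega)]
    rw [i7, i1, i2, i5]
    generalize innerTotal t x (n + 1) = K at *
    generalize (∑ k ∈ Finset.Icc 1 (n + 1), (harmonic k : ℝ) / (k : ℝ) * x ^ k) = S1 at *
    generalize (∑ k ∈ Finset.Icc 1 (n + 1), 1 / (k : ℝ) * x ^ k) = S2 at *
    generalize (∑ k ∈ Finset.Icc 1 (n + 1), (k : ℝ) * x ^ k) = S3 at *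
    generalize (∑ k ∈ Finset.Icc 1 (n + 1), (harmonic k : ℝ) * x ^ k) = S4 at *
    generalize (∑ k ∈ Finset.Icc 1 (n + 1), (k : ℝ) * (harmonic k : ℝ) * x ^ k) = S5 at *
    generalize (∑ k ∈ Finset.Icc 1 (n + 1), x ^ k) = S6 at *
    rw [i3, i4, i6]
    rw [i3] at ih
    generalize invSum x n = P at *
    generalize harmonicInvSum x n = Q at *
    push_cast
    rw [pow_succ x (n + 1), pow_succ x n]
    rw [pow_succ x n] at ih
    generalize x ^ n = X at *
    generalize (harmonic n : ℝ) = h at *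
    -- What remains is an identity of rational functions in `t`, `n`, `l`, `h`, `X`, `P` and `Q`.
    linear_combination (norm := skip) ih
    subst hx
    field_simp
    ring

open intervalIntegral

/-! ### Beta integral and generating function -/

/-- The beta integral at integer arguments. -/
lemma integral_pow_mul_one_sub_pow (n k : ℕ) :
    ((n : ℝ) + 1) * ∫ u in (0 : ℝ)..1, (1 - u) ^ n * u ^ k =
      1 / ((n + 1 + k).choose k : ℝ) := by
  induction n generalizing k with
  | zero =>
    have : (1 + k).choose k = 1 + k := by
      rw [add_comm, Nat.choose_succ_self_right]
    simp only [zero_add, this]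
    simp [add_comm]
  | succ n ih =>
    have hi : ∀ f : ℝ → ℝ, Continuous f → IntervalIntegrable f MeasureTheory.volume 0 1 :=
      fun f hf => hf.intervalIntegrable _ _
    have e : ∫ u in (0 : ℝ)..1, (1 - u) ^ (n + 1) * u ^ k =
        (∫ u in (0 : ℝ)..1, (1 - u) ^ n * u ^ k) -
          ∫ u in (0 : ℝ)..1, (1 - u) ^ n * u ^ (k + 1) := by
      rw [← integral_sub (hi _ (by fun_prop)) (hi _ (by fun_prop))]
      congr 1; ext u; ring
    have h1 := ih k
    have h2 := ih (k + 1)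
    have c1 : ((n + 1 + 1 + k).choose k : ℝ) * (n + 2) = (n + 2 + k) * (n + 1 + k).choose k := by
      have := Nat.choose_mul_succ_eq (n + 1 + k) k
      rw [show n + 1 + k + 1 - k = n + 2 by omega,
        show n + 1 + k + 1 = n + 1 + 1 + k by omega] at this
      have : (((n + 1 + k).choose k * (n + 1 + 1 + k) : ℕ) : ℝ) = _ := congrArg _ this
      push_cast at this
      linarith
    have c2 : ((n + 1 + (k + 1)).choose (k + 1) : ℝ) * (k + 1) =
        (n + 2 + k) * (n + 1 + k).choose k := by
      have := Nat.add_one_mul_choose_eq (n + 1 + k) k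
      have : (((n + 1 + k + 1) * (n + 1 + k).choose k : ℕ) : ℝ) = _ := congrArg _ this
      push_cast at this
      rw [show n + 1 + (k + 1) = n + 1 + k + 1 by omega]
      linarith
    have p1 : ((n + 1 + k).choose k : ℝ) ≠ 0 := by
      exact_mod_cast (Nat.choose_pos (by omega)).ne'
    have p2 : ((n + 1 + 1 + k).choose k : ℝ) ≠ 0 := by
      exact_mod_cast (Nat.choose_pos (by omega)).ne'
    have p3 : ((n + 1 + (k + 1)).choose (k + 1) : ℝ) ≠ 0 := by
      exact_mod_cast (Nat.choose_pos (by omega)).ne'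
    have q1 : (n : ℝ) + 1 ≠ 0 := by positivity
    have q2 : (n : ℝ) + 2 ≠ 0 := by positivity
    have q3 : (k : ℝ) + 1 ≠ 0 := by positivity
    have q4 : (n : ℝ) + 2 + k ≠ 0 := by positivity
    rw [e, eq_div_of_mul_eq q1 ((mul_comm _ _).trans h1),
      eq_div_of_mul_eq q1 ((mul_comm _ _).trans h2),
      eq_div_of_mul_eq q2 c1, eq_div_of_mul_eq q3 c2]
    push_cast
    field_simp
    ring

/-- The sum `log (1 + z) - log (1 + z) / (1 + z)` of `∑_{k ≥ 1} H_{k-1} (-z)^k`. -/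
noncomputable def generating (z : ℝ) : ℝ := Real.log (1 + z) - Real.log (1 + z) / (1 + z)

/-- The remainder of the logarithmic series vanishes at `0` and has derivative `(-z)^N / (1 + z)`,
of absolute value at most `z^N`. The bound does not degenerate as `z` tends to `1`. -/
lemma abs_log_add_sum_le {z : ℝ} (hz : 0 ≤ z) (N : ℕ) :
    |Real.log (1 + z) + ∑ i ∈ Finset.range N, (-z) ^ (i + 1) / ((i : ℝ) + 1)| ≤
      z ^ (N + 1) / ((N : ℝ) + 1) := by
  have key := image_norm_le_of_norm_deriv_right_le_deriv_boundary
    (f := fun y : ℝ => Real.log (1 + y) + ∑ i ∈ Finset.range N, (-y) ^ (i + 1) / ((i : ℝ) + 1))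
    (f' := fun y : ℝ => (-y) ^ N / (1 + y)) (B := fun y : ℝ => y ^ (N + 1) / ((N : ℝ) + 1))
    (B' := fun y : ℝ => y ^ N) (a := 0) (b := z)
  have hd : ∀ y : ℝ, 0 ≤ y → HasDerivAt
      (fun y : ℝ => Real.log (1 + y) + ∑ i ∈ Finset.range N, (-y) ^ (i + 1) / ((i : ℝ) + 1))
      ((-y) ^ N / (1 + y)) y := by
    intro y hy
    have hy1 : (1 : ℝ) + y ≠ 0 := by positivity
    have h1 : HasDerivAt (fun y : ℝ => Real.log (1 + y)) (1 / (1 + y)) y :=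
      ((hasDerivAt_id y).const_add 1).log hy1
    have h2 : HasDerivAt (fun y : ℝ => ∑ i ∈ Finset.range N, (-y) ^ (i + 1) / ((i : ℝ) + 1))
        (∑ i ∈ Finset.range N, -(-y) ^ i) y := by
      refine HasDerivAt.fun_sum fun i _ => ?_
      have h := (((hasDerivAt_id y).neg).pow (i + 1)).div_const ((i : ℝ) + 1)
      refine h.congr_deriv ?_
      have : (i : ℝ) + 1 ≠ 0 := by positivity
      simp; field_simp
    refine (h1.add h2).congr_deriv ?_
    have := geom_sum_mul (-y) N
    rw [Finset.sum_neg_distrib]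
    field_simp
    linear_combination this
  refine key (fun y hy => (hd y hy.1).continuousAt.continuousWithinAt)
    (fun y hy => (hd y hy.1).hasDerivWithinAt) (by simp) (fun y => ?_) (fun y hy => ?_)
    ⟨hz, le_rfl⟩
  · have : (N : ℝ) + 1 ≠ 0 := by positivity
    refine ((hasDerivAt_pow (N + 1) y).div_const ((N : ℝ) + 1)).congr_deriv ?_
    push_cast; field_simp
  · have hy0 := hy.1
    simp only [norm_div, norm_pow, norm_neg, Real.norm_eq_abs, abs_of_nonneg hy0]
    rw [abs_of_pos (by positivity : 0 < 1 + y)]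
    exact div_le_self (by positivity) (by linarith)

lemma one_add_mul_sum_harmonic (z : ℝ) (N : ℕ) :
    (1 + z) * ∑ k ∈ Finset.Icc 1 (N + 1), (-z) ^ k * (harmonic (k - 1) : ℝ) =
      -z * (∑ i ∈ Finset.range N, (-z) ^ (i + 1) / ((i : ℝ) + 1)
        - harmonic N * (-z) ^ (N + 1)) := by
  induction N with
  | zero => simp
  | succ N ih =>
    rw [Finset.sum_Icc_succ_top (by omega), mul_add, ih, Finset.sum_range_succ,
      Nat.add_sub_cancel, harmonic_succ_real]
    ring

lemma harmonic_nonneg_real (N : ℕ) : (0 : ℝ) ≤ harmonic N := by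
  rcases Nat.eq_zero_or_pos N with rfl | h
  · simp
  · exact_mod_cast (harmonic_pos h.ne').le

lemma abs_sum_harmonic_sub_generating_le {z : ℝ} (hz : 0 ≤ z) (N : ℕ) :
    |(∑ k ∈ Finset.Icc 1 (N + 1), (-z) ^ k * (harmonic (k - 1) : ℝ)) - generating z| ≤
      (harmonic N + 1) * z ^ (N + 1) := by
  have h1 : (0 : ℝ) < 1 + z := by positivity
  set s := ∑ i ∈ Finset.range N, (-z) ^ (i + 1) / ((i : ℝ) + 1) with hs
  have hlog := abs_log_add_sum_le hz N
  rw [← hs] at hlog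
  have e : (∑ k ∈ Finset.Icc 1 (N + 1), (-z) ^ k * (harmonic (k - 1) : ℝ)) - generating z =
      (-z / (1 + z)) * ((Real.log (1 + z) + s) - harmonic N * (-z) ^ (N + 1)) := by
    have := one_add_mul_sum_harmonic z N
    rw [← hs] at this
    rw [eq_div_of_mul_eq h1.ne' ((mul_comm _ _).trans this), generating]
    field_simp
    ring
  have hq : |(-z / (1 + z))| ≤ 1 := by
    rw [abs_div, abs_neg, abs_of_nonneg hz, abs_of_pos h1, div_le_one h1]; linarith
  have hH := harmonic_nonneg_real N
  rw [e, abs_mul]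
  refine (mul_le_of_le_one_left (abs_nonneg _) hq).trans ((abs_sub _ _).trans ?_)
  rw [abs_mul, abs_pow, abs_neg, abs_of_nonneg hz, abs_of_nonneg hH]
  have : z ^ (N + 1) / ((N : ℝ) + 1) ≤ z ^ (N + 1) :=
    div_le_self (by positivity) (by linarith [(Nat.cast_nonneg N : (0 : ℝ) ≤ N)])
  linarith

lemma tendsto_harmonic_div :
    Tendsto (fun N : ℕ => ((harmonic N : ℝ) + 1) / ((N : ℝ) + 2)) atTop (𝓝 0) := by
  have hl : Tendsto (fun N : ℕ => (2 + Real.log N) / ((N : ℝ) + 2)) atTop (𝓝 0) := by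
    have h : (fun y : ℝ => 2 + Real.log y) =o[atTop] fun y : ℝ => y + 2 := by
      have hid : (fun y : ℝ => y) =O[atTop] fun y : ℝ => y + 2 := by
        refine Asymptotics.IsBigO.of_bound 1 ?_
        filter_upwards [eventually_ge_atTop 0] with y hy
        rw [Real.norm_of_nonneg hy, Real.norm_of_nonneg (by positivity)]; linarith
      exact (((Asymptotics.isLittleO_const_id_atTop (2 : ℝ)).add
        Real.isLittleO_log_id_atTop)).trans_isBigO hid
    exact h.tendsto_div_nhds_zero.comp tendsto_natCast_atTop_atTop
  refine squeeze_zero (fun N => ?_) (fun N => ?_) hl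
  · have hH := harmonic_nonneg_real N
    positivity
  · have := harmonic_le_one_add_log N
    refine div_le_div_of_nonneg_right ?_ (by positivity)
    linarith

/-! ### The integrals and the limit -/

lemma integral_one_sub_pow (n : ℕ) : ∫ u in (0 : ℝ)..1, (1 - u) ^ n = 1 / ((n : ℝ) + 1) := by
  rw [intervalIntegral.integral_comp_sub_left (fun u => u ^ n) 1]
  simp

section Integrals
variable {t : ℝ} (ht : 0 < t)
include ht

lemma continuousOn_log_one_add_mul :
    ContinuousOn (fun u : ℝ => Real.log (1 + t * u)) (Set.uIcc 0 1) := by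
  refine ContinuousOn.log (by fun_prop) fun u hu => ?_
  rw [Set.uIcc_of_le zero_le_one] at hu
  have := mul_nonneg ht.le hu.1
  positivity

lemma continuousOn_pow_mul_log (n : ℕ) :
    ContinuousOn (fun u : ℝ => (1 - u) ^ n * Real.log (1 + t * u)) (Set.uIcc 0 1) :=
  ContinuousOn.mul (by fun_prop) (continuousOn_log_one_add_mul ht)

lemma intervalIntegrable_div_one_add_mul {f : ℝ → ℝ} (hf : ContinuousOn f (Set.uIcc 0 1)) :
    IntervalIntegrable (fun u => f u / (1 + t * u)) MeasureTheory.volume 0 1 := by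
  refine (hf.div (by fun_prop) fun u hu => ?_).intervalIntegrable
  rw [Set.uIcc_of_le zero_le_one] at hu
  have := mul_nonneg ht.le hu.1
  positivity

lemma one_add_mul_pos {u : ℝ} (hu : u ∈ Set.uIcc (0 : ℝ) 1) : 0 < 1 + t * u := by
  rw [Set.uIcc_of_le zero_le_one] at hu
  have := mul_nonneg ht.le hu.1
  positivity

lemma hasDerivAt_log_one_add_mul {u : ℝ} (hu : u ∈ Set.uIcc (0 : ℝ) 1) :
    HasDerivAt (fun u : ℝ => Real.log (1 + t * u)) (t / (1 + t * u)) u := by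
  have h := (((hasDerivAt_id u).const_mul t).const_add 1).log (one_add_mul_pos ht hu).ne'
  simpa using h

lemma integral_one_sub_pow_div {x : ℝ} (hx : x = (t + 1) / t) (n : ℕ) :
    ∫ u in (0 : ℝ)..1, (1 - u) ^ n * t / (1 + t * u) =
      x ^ n * Real.log (t + 1) - invSum x n := by
  have hxt : x * t = t + 1 := by rw [hx]; field_simp
  induction n with
  | zero =>
    have h := integral_eq_sub_of_hasDerivAt (fun u hu => hasDerivAt_log_one_add_mul ht hu)
      (intervalIntegrable_div_one_add_mul ht (f := fun _ => t) continuousOn_const)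
    simpa [invSum, horner_zero, add_comm] using h
  | succ n ih =>
    -- `1 - u = x - (1 + t u) / t`
    have e : ∫ u in (0 : ℝ)..1, (1 - u) ^ (n + 1) * t / (1 + t * u) =
        ∫ u in (0 : ℝ)..1, (x * ((1 - u) ^ n * t / (1 + t * u)) - (1 - u) ^ n) := by
      refine integral_congr fun u hu => ?_
      have hd := mul_inv_cancel₀ (one_add_mul_pos ht hu).ne'
      simp only [div_eq_mul_inv]
      linear_combination (-(1 - u) ^ n * (1 + t * u)⁻¹) * hxt - (1 - u) ^ n * hd
    rw [e, integral_sub ((intervalIntegrable_div_one_add_mul ht (by fun_prop)).const_mul _)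
      (Continuous.intervalIntegrable (by fun_prop) _ _), integral_const_mul, ih,
      integral_one_sub_pow, invSum, horner_succ]
    ring

/-- Integration by parts. -/
lemma integral_one_sub_pow_mul_log (n : ℕ) :
    ((n : ℝ) + 1) * ∫ u in (0 : ℝ)..1, (1 - u) ^ n * Real.log (1 + t * u) =
      ∫ u in (0 : ℝ)..1, (1 - u) ^ (n + 1) * t / (1 + t * u) := by
  have hv : ∀ u ∈ Set.uIcc (0 : ℝ) 1, HasDerivAt (fun u : ℝ => -(1 - u) ^ (n + 1))
      (((n : ℝ) + 1) * (1 - u) ^ n) u := by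
    intro u _
    have h := (((hasDerivAt_id u).const_sub 1).pow (n + 1)).neg
    refine h.congr_deriv ?_
    simp
  have h := integral_mul_deriv_eq_deriv_mul
    (fun u hu => hasDerivAt_log_one_add_mul ht hu) hv
    (intervalIntegrable_div_one_add_mul ht continuousOn_const)
    (Continuous.intervalIntegrable (by fun_prop) _ _)
  rw [← integral_const_mul]
  calc _ = ∫ u in (0 : ℝ)..1, Real.log (1 + t * u) * (((n : ℝ) + 1) * (1 - u) ^ n) := by
        congr 1; ext u; ring
    _ = _ := by
        rw [h]
        simp only [sub_self, mul_zero, add_zero, Real.log_one, zero_mul, ne_eq,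
          Nat.add_eq_zero_iff, one_ne_zero, and_false, not_false_eq_true, zero_pow, neg_zero,
          zero_sub]
        rw [← integral_neg]
        congr 1; ext u; ring

lemma integral_one_sub_pow_mul_log_div {x : ℝ} (hx : x = (t + 1) / t) (n : ℕ) :
    ∫ u in (0 : ℝ)..1, (1 - u) ^ n * Real.log (1 + t * u) / (1 + t * u) =
      x ^ n / t * (Real.log (t + 1) ^ 2 / 2 - Real.log (t + 1) * harmonic n)
          + (harmonic n * invSum x n - harmonicInvSum x n) / t := by
  have hc := continuousOn_pow_mul_log ht
  induction n with
  | zero =>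
    have h := integral_eq_sub_of_hasDerivAt
      (f := fun u => Real.log (1 + t * u) ^ 2 / (2 * t))
      (f' := fun u => (1 - u) ^ 0 * Real.log (1 + t * u) / (1 + t * u)) (a := 0) (b := 1)
      (fun u hu => by
        have h0 := (one_add_mul_pos ht hu).ne'
        refine (((hasDerivAt_log_one_add_mul ht hu).pow 2).div_const (2 * t)).congr_deriv ?_
        simp; field_simp)
      (intervalIntegrable_div_one_add_mul ht (hc _))
    rw [h]
    simp [invSum, harmonicInvSum, horner_zero, add_comm]
    field_simp
  | succ n ih =>
    have e : ∫ u in (0 : ℝ)..1, (1 - u) ^ (n + 1) * Real.log (1 + t * u) / (1 + t * u) =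
        ∫ u in (0 : ℝ)..1, (x * ((1 - u) ^ n * Real.log (1 + t * u) / (1 + t * u))
          - 1 / t * ((1 - u) ^ n * Real.log (1 + t * u))) := by
      refine integral_congr fun u hu => ?_
      have hd := mul_inv_cancel₀ (one_add_mul_pos ht hu).ne'
      have hxt : x = 1 + t⁻¹ := by rw [hx]; field_simp
      simp only [div_eq_mul_inv, one_mul]
      linear_combination ((1 - u) ^ n * Real.log (1 + t * u)) *
        (-(1 + t * u)⁻¹ * hxt - t⁻¹ * hd + u * (1 + t * u)⁻¹ * mul_inv_cancel₀ ht.ne')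
    have hn : (n : ℝ) + 1 ≠ 0 := by positivity
    have hlog := integral_one_sub_pow_mul_log ht n
    rw [integral_one_sub_pow_div ht hx] at hlog
    rw [e, integral_sub ((intervalIntegrable_div_one_add_mul ht (hc _)).const_mul _)
      ((hc _).intervalIntegrable.const_mul _), integral_const_mul,
      integral_const_mul, ih, eq_div_of_mul_eq hn ((mul_comm _ _).trans hlog),
      harmonic_succ_real, invSum, harmonicInvSum, horner_succ, horner_succ]
    field_simp
    ring

lemma integral_generating {x : ℝ} (hx : x = (t + 1) / t) (n : ℕ) :
    ((n : ℝ) + 1) * ∫ u in (0 : ℝ)..1, (1 - u) ^ n * generating (t * u) =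
      x ^ (n + 1) * Real.log (t + 1) - invSum x (n + 1)
        - (n + 1) * (x ^ n / t * (Real.log (t + 1) ^ 2 / 2 - Real.log (t + 1) * harmonic n)
          + (harmonic n * invSum x n - harmonicInvSum x n) / t) := by
  have hc := continuousOn_pow_mul_log ht
  rw [← integral_one_sub_pow_mul_log_div ht hx, ← integral_one_sub_pow_div ht hx,
    ← integral_one_sub_pow_mul_log ht, ← mul_sub, ← integral_sub
      (hc n).intervalIntegrable
      (intervalIntegrable_div_one_add_mul ht (hc _))]
  congr 2; ext u; rw [generating]; ring

lemma continuousOn_generating :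
    ContinuousOn (fun u : ℝ => generating (t * u)) (Set.uIcc 0 1) :=
  (continuousOn_log_one_add_mul ht).sub ((continuousOn_log_one_add_mul ht).div (by fun_prop)
    fun _ hu => (one_add_mul_pos ht hu).ne')

lemma tendsto_sum_harmonic_div_choose (ht1 : t ≤ 1) (n : ℕ) :
    Tendsto (fun N : ℕ => ∑ k ∈ Finset.Icc 1 N,
        (-t) ^ k * (harmonic (k - 1) : ℝ) / ((n + 1 + k).choose k : ℝ)) atTop
      (𝓝 (((n : ℝ) + 1) * ∫ u in (0 : ℝ)..1, (1 - u) ^ n * generating (t * u))) := by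
  -- The partial sum up to `N + 1` has error at most `(n + 1) (H_N + 1) / (N + 2)`.
  rw [← tendsto_add_atTop_iff_nat 1, tendsto_iff_norm_sub_tendsto_zero]
  have hlim := tendsto_harmonic_div.const_mul ((n : ℝ) + 1)
  rw [mul_zero] at hlim
  refine squeeze_zero (fun _ => norm_nonneg _) (fun N => ?_) hlim
  set F : ℝ → ℝ := fun z => ∑ k ∈ Finset.Icc 1 (N + 1), (-z) ^ k * (harmonic (k - 1) : ℝ)
    with hF
  have hFc : Continuous F := by fun_prop
  have e : ∑ k ∈ Finset.Icc 1 (N + 1),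
      (-t) ^ k * (harmonic (k - 1) : ℝ) / ((n + 1 + k).choose k : ℝ) =
      ((n : ℝ) + 1) * ∫ u in (0 : ℝ)..1, (1 - u) ^ n * F (t * u) := by
    simp only [hF, Finset.mul_sum]
    rw [integral_finsetSum fun k _ => Continuous.intervalIntegrable (by fun_prop) _ _,
      Finset.mul_sum]
    refine Finset.sum_congr rfl fun k _ => ?_
    have : (fun u : ℝ => (1 - u) ^ n * ((-(t * u)) ^ k * (harmonic (k - 1) : ℝ))) =
        fun u => ((-t) ^ k * (harmonic (k - 1) : ℝ)) * ((1 - u) ^ n * u ^ k) := by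
      ext u; rw [← neg_mul, mul_pow]; ring
    rw [this, integral_const_mul, mul_left_comm, integral_pow_mul_one_sub_pow]
    ring
  have hi1 : IntervalIntegrable (fun u => (1 - u) ^ n * F (t * u)) MeasureTheory.volume 0 1 :=
    Continuous.intervalIntegrable (by fun_prop) _ _
  have hi2 : IntervalIntegrable (fun u => (1 - u) ^ n * generating (t * u))
      MeasureTheory.volume 0 1 :=
    (ContinuousOn.mul (by fun_prop) (continuousOn_generating ht)).intervalIntegrable
  have hb : ‖∫ u in (0 : ℝ)..1, ((1 - u) ^ n * F (t * u) - (1 - u) ^ n * generating (t * u))‖ ≤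
      ∫ u in (0 : ℝ)..1, (harmonic N + 1 : ℝ) * u ^ (N + 1) := by
    refine norm_integral_le_of_norm_le zero_le_one (Eventually.of_forall fun u hu => ?_)
      (Continuous.intervalIntegrable (by fun_prop) _ _)
    have hu0 : 0 ≤ u := hu.1.le
    have hu1 : u ≤ 1 := hu.2
    have hz : t * u ≤ u := mul_le_of_le_one_left hu0 ht1
    have hz0 : 0 ≤ t * u := by positivity
    have h := abs_sum_harmonic_sub_generating_le hz0 N
    have hH := harmonic_nonneg_real N
    rw [← mul_sub, norm_mul, norm_pow, Real.norm_of_nonneg (by linarith : 0 ≤ 1 - u)]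
    refine (mul_le_of_le_one_left (norm_nonneg _)
      (pow_le_one₀ (by linarith) (by linarith))).trans (h.trans ?_)
    gcongr
  rw [e, ← mul_sub, ← integral_sub hi1 hi2, norm_mul,
    Real.norm_of_nonneg (by positivity : (0 : ℝ) ≤ (n : ℝ) + 1)]
  refine mul_le_mul_of_nonneg_left (hb.trans_eq ?_) (by positivity)
  rw [integral_const_mul, integral_pow]
  push_cast
  simp
  ring

end Integrals

theorem theorem2p16 (n : ℕ) (hn : 1 ≤ n) (t : ℝ) (ht0 : 0 < t) (ht1 : t ≤ 1) :
    Tendsto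
      (fun N : ℕ => ∑ k ∈ Finset.Icc 1 N,
        (-t) ^ k * (harmonic (k - 1) : ℝ) / ((n + k).choose k : ℝ))
      atTop
      (𝓝 (t * Real.log (t + 1) / (t + 1)
        + t / (t + 1) ^ 2
            * ∑ k ∈ Finset.Icc 1 n, (harmonic k : ℝ) / (k : ℝ) * ((t + 1) / t) ^ k
        - (t ^ 2 + t * Real.log (t + 1)) / (t + 1) ^ 2
            * ∑ k ∈ Finset.Icc 1 n, 1 / (k : ℝ) * ((t + 1) / t) ^ k
        - Real.log (t + 1) ^ 2 / (2 * (t + 1) ^ 2)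
            * ∑ k ∈ Finset.Icc 1 n, (k : ℝ) * ((t + 1) / t) ^ k
        - t / (t + 1) ^ 2
            * ∑ p ∈ Finset.range n, innerHarmonicSum n p * (p : ℝ) * ((t + 1) / t) ^ p
        - 1 / (t + 1) ^ 2
            * ∑ p ∈ Finset.range n, innerHarmonicSum n p * (p : ℝ) ^ 2 * ((t + 1) / t) ^ p
        - (2 * t - t * Real.log (t + 1)) / (t + 1) ^ 2
            * ∑ k ∈ Finset.Icc 1 n, (harmonic k : ℝ) * ((t + 1) / t) ^ k
        + Real.log (t + 1) / (t + 1) ^ 2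
            * ∑ k ∈ Finset.Icc 1 n, (k : ℝ) * (harmonic k : ℝ) * ((t + 1) / t) ^ k
        + (4 * t * Real.log (t + 1) - t * Real.log (t + 1) ^ 2) / (2 * (t + 1) ^ 2)
            * ∑ k ∈ Finset.Icc 1 n, ((t + 1) / t) ^ k)) := by
  obtain ⟨m, rfl⟩ := Nat.exists_eq_add_of_le' hn
  have h := tendsto_sum_harmonic_div_choose ht0 ht1 m
  rw [integral_generating ht0 rfl, ← right_side_eq ht0 rfl] at h
  have e : innerTotal t ((t + 1) / t) (m + 1) =
      t * ∑ p ∈ Finset.range (m + 1),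
          innerHarmonicSum (m + 1) p * (p : ℝ) * ((t + 1) / t) ^ p
        + ∑ p ∈ Finset.range (m + 1),
          innerHarmonicSum (m + 1) p * (p : ℝ) ^ 2 * ((t + 1) / t) ^ p := by
    rw [innerTotal, Finset.mul_sum, ← Finset.sum_add_distrib]
    exact Finset.sum_congr rfl fun p _ => by ring
  rw [e] at h
  convert h using 2
  ring
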